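/- Let $X$ be a measurable space (the instances of a problem), $\mathcal A$ a set of algorithms, and $\mathrm{cost}:\mathcal A\times X\to[0,H]$ a performance measure, measurable in the instance, which is to be minimized or to be maximized. For a probability distribution $D$ on $X$, the error of $A\in\mathcal A$ is $|\mathbb E_{x\sim D}[\mathrm{cost}(A,x)]-\mathrm{opt}(D)|$, where $\mathrm{opt}(D)$ is the infimum (for minimization) or supremum (for maximization) of $\mathbb E_{x\sim D}[\mathrm{cost}(A',x)]$ over $A'\in\mathcal A$, i.e. the value of the optimal algorithm for $D$ if there is one. A finite set $S\subseteq X$ is shattered by $\mathcal A$ if there are reals $(r_x)_{x\in S}$ such that for every $T\subseteq S$ there is $A\in\mathcal A$ with $\mathrm{cost}(A,x)>r_x\iff x\in T$ for all $x\in S$. The pseudo-dimension of $\mathcal A$ is the largest cardinality of a shattered finite set ($+\infty$ if there are arbitrarily large ones). A learning algorithm $L$ maps every finite sample $(x_1,\dots,x_n)$ of instances (repetitions allowed) to an element of $\mathcal A$. It is an empirical risk minimization (ERM) algorithm if its output on every finite sample has the best (least, respectively greatest) average cost on that sample among all elements of $\mathcal A$. It $(\epsilon,\delta)$-learns the optimal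 algorithm in $\mathcal A$ from $m$ samples if, for every probability distribution $D$ on $X$, with probability at least $1-\delta$ over $m$ independent samples $x_1,\dots,x_m\sim D$, the output $L(x_1,\dots,x_m)$ has error at most $\epsilon$. **Corollary.** There is a universal constant $c>0$ such that the following holds for all $X$, $\mathcal A$, $\mathrm{cost}$, $H$ as above, all $\epsilon>0$ and all $\delta\in(0,1]$. Suppose that $\mathcal A$ has finite pseudo-dimension $d$, and let $m\ge0$ be an integer with $$m\ \ge\ c\left(\frac H\epsilon\right)^2\left(d+\ln\frac1\delta\right).$$ Then every ERM algorithm $L$ for which $(x_1,\dots,x_m,y)\mapsto\mathrm{cost}(L(x_1,\dots,x_m),y)$ is a measurable function on $X^m\times X$ $(2\epsilon,\delta)$-learns the optimal algorithm in $\mathcal A$ from $m$ samples. -/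

import Mathlib

open MeasureTheory

namespace AlgSelect

/-- A finite set `S` is (pseudo-)shattered by the class `F` of real-valued functions: there are
witnesses `r x`, `x ∈ S`, such that for every `T ⊆ S` some `h ∈ F` satisfies
`h x > r x ↔ x ∈ T` for all `x ∈ S`. -/
def PseudoShatters {X : Type*} (F : Set (X → ℝ)) (S : Finset X) : Prop :=
  ∃ r : X → ℝ, ∀ T : Finset X, T ⊆ S → ∃ h ∈ F, ∀ x ∈ S, h x > r x ↔ x ∈ T

/-- The pseudo-dimension: the largest cardinality of a shattered finite set, `⊤` if there are
arbitrarily large ones. -/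
noncomputable def pseudoDim {X : Type*} (F : Set (X → ℝ)) : ℕ∞ :=
  ⨆ (S : Finset X) (_ : PseudoShatters F S), (S.card : ℕ∞)

/-- Whether small or large values of the performance measure are the good ones. -/
inductive Goal where
  | minimize
  | maximize

/-- `goal.AsGoodAs a b`: performance `a` is at least as good as performance `b`. -/
def Goal.AsGoodAs : Goal → ℝ → ℝ → Prop
  | .minimize, a, b => a ≤ b
  | .maximize, a, b => b ≤ a

/-- The best value of a family of performances: its infimum or its supremum. It is the value at an
optimal index whenever an optimal index exists. -/
noncomputable def Goal.best {ι : Type*} : Goal → (ι → ℝ) → ℝ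
  | .minimize, v => ⨅ i, v i
  | .maximize, v => ⨆ i, v i

/-- A learning algorithm maps every finite sample of instances in `X` to an element of `𝒜`. -/
abbrev Learner (X 𝒜 : Type*) := (n : ℕ) → (Fin n → X) → 𝒜

/-- The average performance of `A` on a finite sample. -/
noncomputable def avgCost {X 𝒜 : Type*} (cost : 𝒜 → X → ℝ) {n : ℕ} (x : Fin n → X) (A : 𝒜) : ℝ :=
  (∑ i, cost A (x i)) / n

/-- `L` is an empirical risk minimization algorithm: on every finite sample it returns an element
of `𝒜` with the best average performance on the sample. -/
def IsERM {X 𝒜 : Type*} (goal : Goal) (cost : 𝒜 → X → ℝ) (L : Learner X 𝒜) : Prop :=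
  ∀ (n : ℕ) (x : Fin n → X) (A : 𝒜), goal.AsGoodAs (avgCost cost x (L n x)) (avgCost cost x A)

/-- The expected performance of `A` on an instance drawn from `D`. -/
noncomputable def expCost {X 𝒜 : Type*} [MeasurableSpace X] (cost : 𝒜 → X → ℝ) (D : Measure X)
    (A : 𝒜) : ℝ :=
  ∫ x, cost A x ∂D

/-- The error of `A` for `D`: the distance of its expected performance from the optimal one. -/
noncomputable def error {X 𝒜 : Type*} [MeasurableSpace X] (goal : Goal) (cost : 𝒜 → X → ℝ)
    (D : Measure X) (A : 𝒜) : ℝ :=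
  |expCost cost D A - goal.best (expCost cost D)|

/-- `L` `(ε, δ)`-learns the optimal algorithm in `𝒜` from `m` samples: for every distribution `D`,
with probability at least `1 - δ` over `m` independent samples from `D`, the output of `L` has
error at most `ε`. -/
def LearnsOptimal {X 𝒜 : Type*} [MeasurableSpace X] (goal : Goal) (cost : 𝒜 → X → ℝ)
    (L : Learner X 𝒜) (ε δ : ℝ) (m : ℕ) : Prop :=
  ∀ (D : Measure X) [IsProbabilityMeasure D],
    1 - δ ≤ (Measure.pi fun _ : Fin m => D).real {x | error goal cost D (L m x) ≤ ε}

end AlgSelect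
/-!
By symmetrization, the deviation of the empirical from the expected cost of the learner's output is
controlled by its deviation between the sample and a ghost sample, and the law of the double sample
is invariant under random exchanges of the two halves. For a fixed double sample this leaves the
supremum of a sub-Gaussian sign process over the vectors of cost differences. Points of `X × ℝ`
drawn at random distinguish the subgraphs of cost functions that are far apart on the double sample,
so that the Sauer–Shelah lemma bounds packing numbers by the pseudo-dimension `d` (Haussler): there
are nets at scale `4 ^ (-k)` of log-cardinality `O(d * k)`. Chaining along these nets, rather than a
union bound over a single one, avoids a factor `log (H / ε)`.

The learner is then compared with a nearly optimal algorithm, to which Hoeffding's inequality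
applies. If all cost functions coincide there is nothing to learn; otherwise `1 ≤ d`, so that
additive constants are absorbed in `d`.
-/

namespace AlgSelect

open Finset ProbabilityTheory Filter
open scoped NNReal ENNReal

lemma Goal.asGoodAs_best {ι : Type*} (goal : Goal) {v : ι → ℝ} {a b : ℝ}
    (hv : ∀ i, v i ∈ Set.Icc a b) (i : ι) : goal.AsGoodAs (goal.best v) (v i) := by
  cases goal with
  | minimize => exact ciInf_le ⟨a, Set.forall_mem_range.2 fun j => (hv j).1⟩ i
  | maximize => exact le_ciSup ⟨b, Set.forall_mem_range.2 fun j => (hv j).2⟩ i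

lemma Goal.exists_abs_sub_best_le {ι : Type*} [Nonempty ι] (goal : Goal) {v : ι → ℝ} {a b η : ℝ}
    (hv : ∀ i, v i ∈ Set.Icc a b) (hη : 0 < η) : ∃ i, |v i - goal.best v| ≤ η := by
  cases goal with
  | minimize =>
    obtain ⟨i, hi⟩ := exists_lt_of_ciInf_lt (lt_add_of_pos_right (⨅ i, v i) hη)
    have hle : ⨅ i, v i ≤ v i := Goal.minimize.asGoodAs_best hv i
    exact ⟨i, abs_sub_le_iff.2 ⟨by simp only [best]; linarith, by simp only [best]; linarith⟩⟩
  | maximize =>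
    obtain ⟨i, hi⟩ := exists_lt_of_lt_ciSup (sub_lt_self (⨆ i, v i) hη)
    have hle : v i ≤ ⨆ i, v i := Goal.maximize.asGoodAs_best hv i
    exact ⟨i, abs_sub_le_iff.2 ⟨by simp only [best]; linarith, by simp only [best]; linarith⟩⟩

lemma Goal.best_const {ι : Type*} [Nonempty ι] (goal : Goal) (r : ℝ) :
    goal.best (fun _ : ι => r) = r := by
  cases goal <;> simp only [best, ciInf_const, ciSup_const]

lemma Goal.AsGoodAs.abs_sub_le {goal : Goal} {o a a' b b' α β γ : ℝ} (hoa : goal.AsGoodAs o a)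
    (hab : goal.AsGoodAs a' b') (hb : |b - o| ≤ α) (ha' : |a' - a| ≤ β) (hb' : |b' - b| ≤ γ) :
    |a - o| ≤ α + β + γ := by
  rw [abs_le] at *
  cases goal <;> simp only [AsGoodAs] at hoa hab <;> constructor <;> linarith

lemma error_eq_zero_of_subsingleton {X 𝒜 : Type*} [MeasurableSpace X] (goal : Goal)
    {cost : 𝒜 → X → ℝ} (h : (Set.range cost).Subsingleton) (D : Measure X) (A : 𝒜) :
    error goal cost D A = 0 := by
  have : Nonempty 𝒜 := ⟨A⟩
  have hconst : expCost cost D = fun _ => expCost cost D A := by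
    funext B
    rw [expCost, expCost, h (Set.mem_range_self B) (Set.mem_range_self A)]
  rw [error, hconst, goal.best_const, sub_self, abs_zero]

section PseudoDimension

variable {X : Type*} {F : Set (X → ℝ)} {d : ℕ}

lemma PseudoShatters.card_le_pseudoDim {S : Finset X} (hS : PseudoShatters F S) :
    (#S : ℕ∞) ≤ pseudoDim F :=
  le_iSup₂ (f := fun (S : Finset X) (_ : PseudoShatters F S) => (#S : ℕ∞)) S hS

lemma pseudoShatters_singleton {f g : X → ℝ} (hf : f ∈ F) (hg : g ∈ F) {x : X} (hx : f x < g x) :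
    PseudoShatters F {x} := by
  refine ⟨f, fun T hT => ?_⟩
  obtain rfl | rfl := subset_singleton_iff.1 hT
  · exact ⟨f, hf, by simp⟩
  · exact ⟨g, hg, by simpa using hx⟩

lemma one_le_of_pseudoDim_le (hd : pseudoDim F ≤ d) (hF : F.Nontrivial) : 1 ≤ d := by
  obtain ⟨f, hf, g, hg, hfg⟩ := hF
  obtain ⟨x, hx⟩ := Function.ne_iff.1 hfg
  have hshat : PseudoShatters F {x} :=
    hx.lt_or_gt.elim (pseudoShatters_singleton hf hg) (pseudoShatters_singleton hg hf)
  exact_mod_cast hshat.card_le_pseudoDim.trans hd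

open Classical in
/-- The trace of `f` on a finite set `Q` of points of the plane `X × ℝ`: those points of `Q` that
lie strictly below the graph of `f`. Pseudo-shattering is shattering by these subgraphs. -/
noncomputable def subgraphTrace (Q : Finset (X × ℝ)) (f : X → ℝ) : Finset (X × ℝ) :=
  {q ∈ Q | q.2 < f q.1}

lemma mem_subgraphTrace {Q : Finset (X × ℝ)} {f : X → ℝ} {q : X × ℝ} :
    q ∈ subgraphTrace Q f ↔ q ∈ Q ∧ q.2 < f q.1 := by
  classical exact mem_filter

lemma subgraphTrace_subset (Q : Finset (X × ℝ)) (f : X → ℝ) : subgraphTrace Q f ⊆ Q := by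
  classical exact filter_subset _ _

open Classical in
lemma exists_subgraph_of_shatters {Q S : Finset (X × ℝ)} {G : Finset (X → ℝ)} (hG : ↑G ⊆ F)
    (hS : (G.image (subgraphTrace Q)).Shatters S) {T : Finset (X × ℝ)} (hT : T ⊆ S) :
    ∃ f ∈ F, ∀ q ∈ S, q.2 < f q.1 ↔ q ∈ T := by
  have hSQ : S ⊆ Q := by
    obtain ⟨_, hu, hSu⟩ := hS subset_rfl
    obtain ⟨f, -, rfl⟩ := mem_image.1 hu
    exact (inter_eq_left.1 hSu).trans (subgraphTrace_subset Q f)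
  obtain ⟨_, hu, hSu⟩ := hS hT
  obtain ⟨f, hf, rfl⟩ := mem_image.1 hu
  refine ⟨f, hG hf, fun q hq => ?_⟩
  rw [← hSu, mem_inter, mem_subgraphTrace]
  exact ⟨fun h => ⟨hq, hSQ hq, h⟩, fun h => h.2.2⟩

lemma injOn_fst_of_forall_exists_subgraph {S : Finset (X × ℝ)}
    (hS : ∀ T ⊆ S, ∃ f ∈ F, ∀ q ∈ S, q.2 < f q.1 ↔ q ∈ T) :
    Set.InjOn Prod.fst (S : Set (X × ℝ)) := by
  have eq_of_le : ∀ q ∈ S, ∀ q' ∈ S, q.1 = q'.1 → q.2 ≤ q'.2 → q = q' := by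
    intro q hq q' hq' hfst hsnd
    obtain ⟨f, -, hf⟩ := hS {q'} (singleton_subset_iff.2 hq')
    have hq'f : q'.2 < f q'.1 := (hf q' hq').2 (mem_singleton_self q')
    exact mem_singleton.1 ((hf q hq).1 (hfst ▸ hsnd.trans_lt hq'f))
  intro q hq q' hq' hfst
  rcases le_total q.2 q'.2 with h | h
  · exact eq_of_le q hq q' hq' hfst h
  · exact (eq_of_le q' hq' q hq hfst.symm h).symm

lemma card_le_pseudoDim_of_forall_exists_subgraph {S : Finset (X × ℝ)}
    (hS : ∀ T ⊆ S, ∃ f ∈ F, ∀ q ∈ S, q.2 < f q.1 ↔ q ∈ T) : (#S : ℕ∞) ≤ pseudoDim F := by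
  classical
  have hinj := injOn_fst_of_forall_exists_subgraph hS
  rw [← card_image_of_injOn hinj]
  refine PseudoShatters.card_le_pseudoDim ?_
  choose! lift hlift_mem hlift_fst using fun x (hx : x ∈ S.image Prod.fst) => mem_image.1 hx
  refine ⟨fun x => (lift x).2, fun T _ => ?_⟩
  obtain ⟨f, hf, hfS⟩ := hS {q ∈ S | q.1 ∈ T} (filter_subset _ _)
  refine ⟨f, hf, fun x hx => ?_⟩
  have := hfS (lift x) (hlift_mem x hx)
  rw [mem_filter, hlift_fst x hx] at this
  exact this.trans (and_iff_right (hlift_mem x hx))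

open Classical in
lemma vcDim_image_subgraphTrace_le (hd : pseudoDim F ≤ d) (Q : Finset (X × ℝ))
    {G : Finset (X → ℝ)} (hG : ↑G ⊆ F) : (G.image (subgraphTrace Q)).vcDim ≤ d := by
  refine Finset.sup_le fun S hS => ?_
  have hcard : (#S : ℕ∞) ≤ pseudoDim F := card_le_pseudoDim_of_forall_exists_subgraph fun _ =>
    exists_subgraph_of_shatters hG (mem_shatterer.1 hS)
  exact_mod_cast hcard.trans hd

/-- Weighted form of the Sauer–Shelah lemma. -/
lemma pow_mul_card_le_one_add_pow {α : Type*} [DecidableEq α] {d : ℕ} {𝒢 : Finset (Finset α)}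
    {Q : Finset α} (h𝒢 : 𝒢.vcDim ≤ d) (hQ : ∀ s ∈ 𝒢, s ⊆ Q) {x : ℝ} (hx : 0 ≤ x) (hx1 : x ≤ 1) :
    x ^ d * #𝒢 ≤ (1 + x) ^ #Q := by
  have hsub : 𝒢.shatterer ⊆ Q.powerset := fun S hS => by
    obtain ⟨u, hu, hSu⟩ := mem_shatterer.1 hS subset_rfl
    exact mem_powerset.2 ((inter_eq_left.1 hSu).trans (hQ u hu))
  calc x ^ d * (#𝒢 : ℝ) ≤ x ^ d * #𝒢.shatterer := by
        have := 𝒢.card_le_card_shatterer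
        gcongr
    _ = ∑ _ ∈ 𝒢.shatterer, x ^ d := by rw [sum_const, nsmul_eq_mul, mul_comm]
    _ ≤ ∑ S ∈ 𝒢.shatterer, x ^ #S * 1 ^ (#Q - #S) := by
        refine sum_le_sum fun S hS => ?_
        rw [one_pow, mul_one]
        exact pow_le_pow_of_le_one hx hx1 ((mem_shatterer.1 hS).card_le_vcDim.trans h𝒢)
    _ ≤ ∑ S ∈ Q.powerset, x ^ #S * 1 ^ (#Q - #S) :=
        sum_le_sum_of_subset_of_nonneg hsub fun _ _ _ => by positivity
    _ = (1 + x) ^ #Q := by rw [sum_pow_mul_eq_add_pow, add_comm]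

end PseudoDimension

section Packing

variable {X : Type*} {F : Set (X → ℝ)} {H η : ℝ} {d : ℕ}

/-- The point `q` of the plane `X × ℝ` lies below the graph of exactly one of the functions `f` and
`g`. A random point with `X`-coordinate `x` does so with probability proportional to
`|f x - g x|`. -/
def Separates (q : X × ℝ) (f g : X → ℝ) : Prop :=
  ¬(q.2 < f q.1 ↔ q.2 < g q.1)

lemma setOf_separates (x : X) (f g : X → ℝ) :
    {t | Separates (x, t) f g} = Set.Ico (min (f x) (g x)) (max (f x) (g x)) := by
  ext t
  simp only [Separates, Set.mem_ofPred_eq, Set.mem_Ico, min_le_iff, lt_max_iff]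
  simp only [← not_lt]
  tauto

lemma setIntegral_indicator_separates {x : X} {f g : X → ℝ} (hf : f x ∈ Set.Icc 0 H)
    (hg : g x ∈ Set.Icc 0 H) :
    ∫ t in Set.Icc 0 H, {t | Separates (x, t) f g}.indicator (1 : ℝ → ℝ) t = |f x - g x| := by
  have hsub : Set.Ico (min (f x) (g x)) (max (f x) (g x)) ⊆ Set.Icc 0 H := fun t ht =>
    ⟨(le_min hf.1 hg.1).trans ht.1, ht.2.le.trans (max_le hf.2 hg.2)⟩
  rw [setOf_separates, setIntegral_indicator measurableSet_Ico, Set.inter_eq_right.2 hsub]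
  simp [max_sub_min_eq_abs, abs_sub_comm]

open Classical in
lemma exists_separating_point {ι : Type*} [Fintype ι] [Nonempty ι] (hH : 0 < H)
    (hF : ∀ f ∈ F, ∀ x, f x ∈ Set.Icc 0 H) (z : ι → X) {P : Finset ((X → ℝ) × (X → ℝ))}
    (hPF : ∀ p ∈ P, p.1 ∈ F ∧ p.2 ∈ F)
    (hP : ∀ p ∈ P, η * Fintype.card ι * H ≤ ∑ i, |p.1 (z i) - p.2 (z i)|) :
    ∃ q : X × ℝ, η * #P ≤ #{p ∈ P | Separates q p.1 p.2} := by
  set φ : ι → (X → ℝ) × (X → ℝ) → ℝ → ℝ := fun i p =>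
    {t | Separates (z i, t) p.1 p.2}.indicator 1 with hφ
  have hφ_int (i p) : IntegrableOn (φ i p) (Set.Icc 0 H) := by
    simp only [hφ, setOf_separates]
    exact (integrable_const (1 : ℝ)).indicator measurableSet_Ico
  have hφ_sum_int : IntegrableOn (fun t => ∑ i, ∑ p ∈ P, φ i p t) (Set.Icc 0 H) :=
    integrable_finsetSum _ fun i _ => integrable_finsetSum _ fun p _ => hφ_int i p
  have haverage : η * #P * Fintype.card ι ≤ ⨍ t in Set.Icc 0 H, ∑ i, ∑ p ∈ P, φ i p t := by
    rw [setAverage_eq, Real.volume_real_Icc_of_le hH.le, sub_zero, smul_eq_mul,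
      le_inv_mul_iff₀ hH, integral_finsetSum _ fun i _ => integrable_finsetSum _ fun p _ =>
        hφ_int i p]
    calc H * (η * #P * Fintype.card ι) = ∑ _ ∈ P, η * Fintype.card ι * H := by
          rw [sum_const, nsmul_eq_mul]; ring
      _ ≤ ∑ p ∈ P, ∑ i, |p.1 (z i) - p.2 (z i)| := sum_le_sum hP
      _ = ∑ i, ∑ p ∈ P, ∫ t in Set.Icc 0 H, φ i p t := by
          rw [sum_comm]
          refine sum_congr rfl fun i _ => sum_congr rfl fun p hp => ?_
          exact (setIntegral_indicator_separates (hF _ (hPF p hp).1 _) (hF _ (hPF p hp).2 _)).symm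
      _ = ∑ i, ∫ t in Set.Icc 0 H, ∑ p ∈ P, φ i p t :=
          sum_congr rfl fun i _ => (integral_finsetSum _ fun p _ => hφ_int i p).symm
  obtain ⟨t, -, ht⟩ := exists_setAverage_le (by simpa using hH) measure_Icc_lt_top.ne hφ_sum_int
  obtain ⟨i, -, hi⟩ : ∃ i ∈ univ, η * #P ≤ ∑ p ∈ P, φ i p t := by
    refine exists_le_of_sum_le univ_nonempty ?_
    rw [sum_const, nsmul_eq_mul, card_univ, mul_comm]
    exact haverage.trans ht
  refine ⟨(z i, t), hi.trans_eq ?_⟩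
  simp only [hφ, Set.indicator_apply, Pi.one_apply, sum_boole, Set.mem_ofPred_eq]

open Classical in
lemma exists_separating_points {ι : Type*} [Fintype ι] [Nonempty ι] (hH : 0 < H) (hη1 : η ≤ 1)
    (hF : ∀ f ∈ F, ∀ x, f x ∈ Set.Icc 0 H) (z : ι → X) {P : Finset ((X → ℝ) × (X → ℝ))}
    (hPF : ∀ p ∈ P, p.1 ∈ F ∧ p.2 ∈ F)
    (hP : ∀ p ∈ P, η * Fintype.card ι * H ≤ ∑ i, |p.1 (z i) - p.2 (z i)|) (k : ℕ) :
    ∃ Q : Finset (X × ℝ), #Q ≤ k ∧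
      (#{p ∈ P | ∀ q ∈ Q, ¬Separates q p.1 p.2} : ℝ) ≤ (1 - η) ^ k * #P := by
  induction k with
  | zero => exact ⟨∅, by simp, by simp⟩
  | succ k ih =>
    obtain ⟨Q, hQ, hQP⟩ := ih
    set P' := {p ∈ P | ∀ q ∈ Q, ¬Separates q p.1 p.2} with hP'
    have hsub : P' ⊆ P := filter_subset _ _
    obtain ⟨q, hq⟩ := exists_separating_point hH hF z (fun p hp => hPF p (hsub hp))
      fun p hp => hP p (hsub hp)
    refine ⟨insert q Q, (card_insert_le _ _).trans (Nat.succ_le_succ hQ), ?_⟩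
    have hinsert : {p ∈ P | ∀ q' ∈ insert q Q, ¬Separates q' p.1 p.2} =
        {p ∈ P' | ¬Separates q p.1 p.2} := by
      simp only [hP', filter_filter, forall_mem_insert, and_comm]
    have hcard : (#{p ∈ P' | Separates q p.1 p.2} : ℝ) + #{p ∈ P' | ¬Separates q p.1 p.2} = #P' :=
      mod_cast card_filter_add_card_filter_not (s := P') fun p => Separates q p.1 p.2
    calc (#{p ∈ P | ∀ q' ∈ insert q Q, ¬Separates q' p.1 p.2} : ℝ)
        ≤ (1 - η) * #P' := by rw [hinsert]; linarith
      _ ≤ (1 - η) * ((1 - η) ^ k * #P) := mul_le_mul_of_nonneg_left hQP (sub_nonneg.2 hη1)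
      _ = (1 - η) ^ (k + 1) * #P := by ring

lemma one_sub_pow_mul_card_offDiag_lt_one {α : Type*} (G : Finset α) (hη : 0 < η)
    (hη1 : η ≤ 1) {k : ℕ} (hk : 2 * Real.log #G / η ≤ k) : (1 - η) ^ k * #G.offDiag < 1 := by
  rcases G.eq_empty_or_nonempty with rfl | hG
  · simp
  have hG0 : (0 : ℝ) < #G := mod_cast hG.card_pos
  have hpow : (1 - η) ^ k ≤ 1 / (#G : ℝ) ^ 2 := by
    calc (1 - η) ^ k ≤ Real.exp (-η) ^ k := by
          have := Real.one_sub_le_exp_neg η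
          gcongr
      _ = Real.exp (-(k * η)) := by rw [← Real.exp_nat_mul, mul_neg]
      _ ≤ Real.exp (-(2 * Real.log #G)) :=
          Real.exp_le_exp.2 (neg_le_neg ((div_le_iff₀ hη).1 hk))
      _ = 1 / (#G : ℝ) ^ 2 := by
          rw [Real.exp_neg, two_mul, Real.exp_add, Real.exp_log hG0, one_div, sq]
  have hoff : (#G.offDiag : ℝ) < #G ^ 2 := by
    have := Nat.mul_pos hG.card_pos hG.card_pos
    rw [offDiag_card, sq]
    exact_mod_cast (by lia : #G * #G - #G < #G * #G)
  calc (1 - η) ^ k * #G.offDiag ≤ 1 / #G ^ 2 * #G.offDiag := by gcongr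
    _ < 1 / #G ^ 2 * #G ^ 2 := by gcongr
    _ = 1 := by field_simp

lemma exists_separating_points_of_packing {ι : Type*} [Fintype ι] [Nonempty ι] (hH : 0 < H)
    (hη : 0 < η) (hη1 : η ≤ 1) (hF : ∀ f ∈ F, ∀ x, f x ∈ Set.Icc 0 H) (z : ι → X)
    {G : Finset (X → ℝ)} (hGF : ↑G ⊆ F)
    (hG : (G : Set (X → ℝ)).Pairwise fun f g =>
      η * Fintype.card ι * H ≤ ∑ i, |f (z i) - g (z i)|) :
    ∃ Q : Finset (X × ℝ), #Q ≤ ⌈2 * Real.log #G / η⌉₊ ∧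
      (G : Set (X → ℝ)).Pairwise fun f g => ∃ q ∈ Q, Separates q f g := by
  classical
  obtain ⟨Q, hQ, hunsep⟩ := exists_separating_points (P := G.offDiag) hH hη1 hF z
    (fun p hp => ⟨hGF (mem_offDiag.1 hp).1, hGF (mem_offDiag.1 hp).2.1⟩)
    (fun p hp => hG (mem_offDiag.1 hp).1 (mem_offDiag.1 hp).2.1 (mem_offDiag.1 hp).2.2)
    ⌈2 * Real.log #G / η⌉₊
  refine ⟨Q, hQ, fun f hf g hg hfg => ?_⟩
  have hnone : #{p ∈ G.offDiag | ∀ q ∈ Q, ¬Separates q p.1 p.2} = 0 :=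
    Nat.lt_one_iff.1 <| mod_cast hunsep.trans_lt <|
      one_sub_pow_mul_card_offDiag_lt_one G hη hη1 (Nat.le_ceil _)
  have hmem : (f, g) ∈ G.offDiag := mem_offDiag.2 ⟨hf, hg, hfg⟩
  simpa using filter_eq_empty_iff.1 (card_eq_zero.1 hnone) hmem

lemma injOn_subgraphTrace {Q : Finset (X × ℝ)} {G : Set (X → ℝ)}
    (hG : G.Pairwise fun f g => ∃ q ∈ Q, Separates q f g) : Set.InjOn (subgraphTrace Q) G := by
  intro f hf g hg hfg
  by_contra hne
  obtain ⟨q, hq, hsep⟩ := hG hf hg hne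
  have := Finset.ext_iff.1 hfg q
  simp only [mem_subgraphTrace, hq, true_and] at this
  exact hsep this

lemma log_card_packing_le {ι : Type*} [Fintype ι] [Nonempty ι] (hd : 1 ≤ d)
    (hdim : pseudoDim F ≤ d) (hH : 0 < H) (hη : 0 < η) (hη1 : η ≤ 1)
    (hF : ∀ f ∈ F, ∀ x, f x ∈ Set.Icc 0 H) (z : ι → X) {G : Finset (X → ℝ)} (hGF : ↑G ⊆ F)
    (hG : (G : Set (X → ℝ)).Pairwise fun f g =>
      η * Fintype.card ι * H ≤ ∑ i, |f (z i) - g (z i)|) :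
    Real.log #G ≤ 3 * d * Real.log (4 / η) := by
  classical
  have hd1 : (1 : ℝ) ≤ d := mod_cast hd
  have hlog4 : 1 ≤ Real.log (4 / η) := by
    rw [Real.le_log_iff_exp_le (by positivity), le_div_iff₀ hη]
    nlinarith [Real.exp_one_lt_d9]
  rcases G.eq_empty_or_nonempty with rfl | hG0
  · simp only [card_empty, CharP.cast_eq_zero, Real.log_zero]
    positivity
  have hN : (1 : ℝ) ≤ #G := mod_cast hG0.card_pos
  have hlogN := Real.log_nonneg hN
  obtain ⟨Q, hQ, hsep⟩ := exists_separating_points_of_packing hH hη hη1 hF z hGF hG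
  have hQ' : (#Q : ℝ) ≤ 2 * Real.log #G / η + 1 :=
    (Nat.cast_le.2 hQ).trans (Nat.ceil_lt_add_one (by positivity)).le
  have hsauer : (η / 4) ^ d * #G ≤ (1 + η / 4) ^ #Q := by
    rw [← card_image_of_injOn (injOn_subgraphTrace hsep)]
    exact pow_mul_card_le_one_add_pow (vcDim_image_subgraphTrace_le hdim Q hGF)
      (forall_mem_image.2 fun f _ => subgraphTrace_subset Q f) (by positivity) (by linarith)
  -- The weight `η / 4` makes the right-hand side at most `√#G` up to a constant factor.
  have hupper : #Q * Real.log (1 + η / 4) ≤ Real.log #G / 2 + η / 4 := by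
    calc #Q * Real.log (1 + η / 4) ≤ (2 * Real.log #G / η + 1) * (η / 4) := by
          gcongr
          · exact Real.log_nonneg (by linarith)
          · linarith [Real.log_le_sub_one_of_pos (show 0 < 1 + η / 4 by positivity)]
      _ = Real.log #G / 2 + η / 4 := by field_simp; ring
  have hlog_inv : Real.log (η / 4) = -Real.log (4 / η) := by rw [← Real.log_inv, inv_div]
  have hlog := Real.log_le_log (by positivity) hsauer
  rw [Real.log_mul (by positivity) (by positivity), Real.log_pow, Real.log_pow,
    hlog_inv] at hlog
  nlinarith

end Packing

section Cover

lemma exists_finset_forall_exists_dist_le {E : Type*} [PseudoMetricSpace E] {A : Set E} {r M : ℝ}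
    (hr : 0 ≤ r) (hM : ∀ G : Finset E, ↑G ⊆ A →
      (G : Set E).Pairwise (fun v w => r < dist v w) → (#G : ℝ) ≤ M) :
    ∃ N : Finset E, (#N : ℝ) ≤ M ∧ ∀ v ∈ A, ∃ w ∈ N, dist v w ≤ r := by
  lift r to ℝ≥0 using hr
  have dist_of_isSeparated {C : Set E} (hC : Metric.IsSeparated r C) :
      C.Pairwise fun v w => (r : ℝ) < dist v w := hC.imp fun v w hvw => by
    rwa [edist_nndist, ENNReal.coe_lt_coe, ← NNReal.coe_lt_coe, coe_nndist] at hvw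
  have hpacking : Metric.packingNumber r A ≤ ⌊M⌋₊ := by
    refine iSup₂_le fun C hCA => iSup_le fun hC => ?_
    by_contra! hlt
    obtain ⟨G, hGC, hG⟩ := Set.exists_subset_encard_eq (Order.add_one_le_of_lt hlt)
    lift G to Finset E using Set.finite_of_encard_eq_coe (k := ⌊M⌋₊ + 1) (mod_cast hG)
    have hcard : #G = ⌊M⌋₊ + 1 := by
      rw [Set.encard_coe_eq_coe_finsetCard] at hG
      exact_mod_cast hG
    have := Nat.le_floor (hM G (hGC.trans hCA) (dist_of_isSeparated (hC.subset hGC)))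
    lia
  have hfin : Metric.packingNumber r A ≠ ⊤ := ne_top_of_le_ne_top (ENat.natCast_ne_top _) hpacking
  lift Metric.maximalSeparatedSet r A to Finset E using Set.encard_ne_top_iff.1 <| by
    rwa [Metric.encard_maximalSeparatedSet hfin] with N hN
  refine ⟨N, hM N (hN ▸ Metric.maximalSeparatedSet_subset)
    (dist_of_isSeparated (hN ▸ Metric.isSeparated_maximalSeparatedSet)), fun v hv => ?_⟩
  obtain ⟨w, hw, hvw⟩ := (hN ▸ Metric.isCover_maximalSeparatedSet hfin) hv
  exact ⟨w, hw, by exact_mod_cast (edist_le_coe.1 hvw)⟩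

variable {X ι : Type*} [Fintype ι] {F : Set (X → ℝ)} {H η : ℝ} {d : ℕ}

/-- The differences of the values of `f` on a double sample `(x, y)`, as a vector whose Euclidean
norm controls the symmetrized process. -/
noncomputable def sampleDiff (x y : ι → X) (f : X → ℝ) : EuclideanSpace ℝ ι :=
  WithLp.toLp 2 fun i => f (y i) - f (x i)

lemma norm_sampleDiff_le (hH : 0 ≤ H) {f : X → ℝ} (hf : ∀ x, f x ∈ Set.Icc 0 H) (x y : ι → X) :
    ‖sampleDiff x y f‖ ≤ H * √(Fintype.card ι) := by
  have hle (i : ι) : (sampleDiff x y f i) ^ 2 ≤ H ^ 2 := by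
    have hi := abs_sub_le_of_le_of_le (hf (y i)).1 (hf (y i)).2 (hf (x i)).1 (hf (x i)).2
    rw [sub_zero] at hi
    exact sq_le_sq' (abs_le.1 hi).1 (abs_le.1 hi).2
  rw [EuclideanSpace.norm_eq, mul_comm, ← Real.sqrt_sq hH, ← Real.sqrt_mul (Nat.cast_nonneg _)]
  refine Real.sqrt_le_sqrt ((sum_le_card_nsmul _ _ (H ^ 2) fun i _ => ?_).trans_eq ?_)
  · rw [Real.norm_eq_abs, sq_abs]
    exact hle i
  · rw [nsmul_eq_mul, card_univ]

lemma norm_sampleDiff_sub_sq_le (hF : ∀ f ∈ F, ∀ x, f x ∈ Set.Icc 0 H) (x y : ι → X) {f g : X → ℝ}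
    (hf : f ∈ F) (hg : g ∈ F) : ‖sampleDiff x y f - sampleDiff x y g‖ ^ 2 ≤
      2 * H * ∑ j, |f (Sum.elim x y j) - g (Sum.elim x y j)| := by
  rw [EuclideanSpace.real_norm_sq_eq, Fintype.sum_sum_type, ← sum_add_distrib, mul_sum]
  refine sum_le_sum fun i _ => ?_
  have hle (z : X) : |f z - g z| ≤ H := by
    simpa using abs_sub_le_of_le_of_le (hF f hf z).1 (hF f hf z).2 (hF g hg z).1 (hF g hg z).2
  have hx := hle (x i)
  have hy := hle (y i)
  have htri := abs_sub (f (y i) - g (y i)) (f (x i) - g (x i))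
  calc (f (y i) - f (x i) - (g (y i) - g (x i))) ^ 2
      = |f (y i) - g (y i) - (f (x i) - g (x i))| ^ 2 := by rw [sq_abs]; ring
    _ ≤ (|f (y i) - g (y i)| + |f (x i) - g (x i)|) ^ 2 := by gcongr
    _ ≤ 2 * H * (|f (x i) - g (x i)| + |f (y i) - g (y i)|) := by
        nlinarith [abs_nonneg (f (y i) - g (y i)), abs_nonneg (f (x i) - g (x i))]

lemma exists_net_sampleDiff [Nonempty ι] (hd : 1 ≤ d) (hdim : pseudoDim F ≤ d) (hH : 0 < H)
    (hF : ∀ f ∈ F, ∀ x, f x ∈ Set.Icc 0 H) (x y : ι → X) {s : ℝ} (hs : 1 ≤ s) :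
    ∃ N : Finset (EuclideanSpace ℝ ι), (#N : ℝ) ≤ Real.exp (3 * d * Real.log (4 * s ^ 2)) ∧
      ∀ v ∈ sampleDiff x y '' F, ∃ w ∈ N, ‖v - w‖ ≤ 2 * H * √(Fintype.card ι) / s := by
  simp only [← dist_eq_norm]
  refine exists_finset_forall_exists_dist_le (by positivity) fun V hVF hV => ?_
  classical
  obtain ⟨G, hGF, hGinj, rfl⟩ := Finset.exists_subset_injOn_image_eq_of_surjOn F V hVF
  rw [card_image_of_injOn hGinj]
  rcases G.eq_empty_or_nonempty with rfl | hG0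
  · simpa using (Real.exp_pos _).le
  rw [← Real.log_le_iff_le_exp (mod_cast hG0.card_pos), ← div_inv_eq_mul 4]
  refine log_card_packing_le hd hdim hH (by positivity) (inv_le_one_of_one_le₀ (one_le_pow₀ hs)) hF
    (Sum.elim x y) hGF fun f hf g hg hfg => ?_
  have hsep : 2 * H * √(Fintype.card ι) / s < ‖sampleDiff x y f - sampleDiff x y g‖ := by
    rw [← dist_eq_norm]
    exact hV (mem_image_of_mem _ hf) (mem_image_of_mem _ hg) (hGinj.ne hf hg hfg)
  refine le_of_mul_le_mul_left ?_ (by positivity : 0 < 2 * H)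
  calc 2 * H * ((s ^ 2)⁻¹ * Fintype.card (ι ⊕ ι) * H)
      = (2 * H * √(Fintype.card ι) / s) ^ 2 := by
        rw [div_pow, mul_pow, Real.sq_sqrt (Nat.cast_nonneg _), Fintype.card_sum]
        push_cast
        ring
    _ ≤ ‖sampleDiff x y f - sampleDiff x y g‖ ^ 2 := by gcongr
    _ ≤ _ := norm_sampleDiff_sub_sq_le hF x y (hGF hf) (hGF hg)

lemma three_mul_log_four_mul_sq_le {k : ℕ} (hk : 1 ≤ k) :
    3 * Real.log (4 * (4 ^ k) ^ 2) ≤ 13 * k := by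
  have hk1 : (1 : ℝ) ≤ k := mod_cast hk
  have hpow : (4 : ℝ) * (4 ^ k) ^ 2 = 2 ^ (2 * (2 * k + 1)) := by
    rw [pow_mul 2 2, ← pow_mul, mul_comm k, ← pow_succ']
    norm_num
  rw [hpow, Real.log_pow]
  push_cast
  nlinarith [Real.log_two_lt_d9]

lemma exists_nets_sampleDiff [Nonempty ι] (hd : 1 ≤ d) (hdim : pseudoDim F ≤ d) (hH : 0 < H)
    (hF : ∀ f ∈ F, ∀ x, f x ∈ Set.Icc 0 H) (x y : ι → X) :
    ∃ N : ℕ → Finset (EuclideanSpace ℝ ι), N 0 = {0} ∧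
      (∀ k, (#(N k) : ℝ) ≤ Real.exp (13 * d * k)) ∧
      ∀ k, ∀ v ∈ sampleDiff x y '' F, ∃ w ∈ N k, ‖v - w‖ ≤ 2 * H * √(Fintype.card ι) / 4 ^ k := by
  choose N hNcard hN using fun k : ℕ =>
    exists_net_sampleDiff hd hdim hH hF x y (one_le_pow₀ (by norm_num : (1 : ℝ) ≤ 4) (n := k))
  refine ⟨Function.update N 0 {0}, Function.update_self .., fun k => ?_, fun k v hv => ?_⟩ <;>
    rcases k.eq_zero_or_pos with rfl | hk
  · simp
  · rw [Function.update_of_ne hk.ne']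
    refine (hNcard k).trans (Real.exp_le_exp.2 ?_)
    nlinarith [three_mul_log_four_mul_sq_le hk, (Nat.cast_nonneg d : (0 : ℝ) ≤ d)]
  · obtain ⟨f, hf, rfl⟩ := hv
    refine ⟨0, by simp, ?_⟩
    rw [sub_zero, pow_zero, div_one]
    have := norm_sampleDiff_le hH.le (hF f hf) x y
    linarith [norm_nonneg (sampleDiff x y f)]
  · rw [Function.update_of_ne hk.ne']
    exact hN k v hv

end Cover

section SubGaussian

lemma hasSubgaussianMGF_mono {Ω : Type*} [MeasurableSpace Ω] {P : Measure Ω} {Y : Ω → ℝ}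
    {c c' : ℝ≥0} (h : HasSubgaussianMGF Y c P) (hcc : c ≤ c') : HasSubgaussianMGF Y c' P where
  integrable_exp_mul := h.integrable_exp_mul
  mgf_le t := (h.mgf_le t).trans (by gcongr)

lemma measureReal_le_abs_le_of_hasSubgaussianMGF {Ω : Type*} [MeasurableSpace Ω] {P : Measure Ω}
    {Y : Ω → ℝ} {c : ℝ≥0} (h : HasSubgaussianMGF Y c P) {s : ℝ} (hs : 0 ≤ s) :
    P.real {ω | s ≤ |Y ω|} ≤ 2 * Real.exp (-s ^ 2 / (2 * c)) := by
  have hunion : {ω | s ≤ |Y ω|} = {ω | s ≤ Y ω} ∪ {ω | s ≤ (-Y) ω} := by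
    ext ω
    exact le_abs (b := Y ω)
  rw [hunion, two_mul]
  exact (measureReal_union_le _ _).trans (add_le_add (h.measure_ge_le hs) (h.neg.measure_ge_le hs))

variable {ι : Type*} [Fintype ι]

lemma hasSubgaussianMGF_sum_pi {X : ι → Type*} [∀ i, MeasurableSpace (X i)]
    (μ : ∀ i, Measure (X i)) [∀ i, IsProbabilityMeasure (μ i)] {f : ∀ i, X i → ℝ} {a b : ι → ℝ}
    (hf : ∀ i, Measurable (f i)) (hab : ∀ i x, f i x ∈ Set.Icc (a i) (b i)) :
    HasSubgaussianMGF (fun x : ∀ i, X i => ∑ i, (f i (x i) - ∫ y, f i y ∂μ i))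
      (∑ i, (‖b i - a i‖₊ / 2) ^ 2) (Measure.pi μ) := by
  refine HasSubgaussianMGF.sum_of_iIndepFun
    (iIndepFun_pi (X := fun i y => f i y - ∫ y, f i y ∂μ i)
      fun i => ((hf i).sub_const _).aemeasurable) fun i _ => ?_
  rw [← integral_comp_eval (μ := μ) (hf i).aestronglyMeasurable]
  exact hasSubgaussianMGF_of_mem_Icc ((hf i).comp (measurable_pi_apply i)).aemeasurable
    (.of_forall fun x => hab i (x i))

lemma measureReal_hoeffding {X : Type*} [MeasurableSpace X] (D : Measure X)
    [IsProbabilityMeasure D] {f : X → ℝ} (hf : Measurable f) {H : ℝ}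
    (hfH : ∀ x, f x ∈ Set.Icc 0 H) {s : ℝ} (hs : 0 ≤ s) :
    (Measure.pi fun _ : ι => D).real {x | s ≤ |∑ i, (f (x i) - ∫ y, f y ∂D)|} ≤
      2 * Real.exp (-(2 * s ^ 2 / (Fintype.card ι * H ^ 2))) := by
  refine (measureReal_le_abs_le_of_hasSubgaussianMGF
    (hasSubgaussianMGF_sum_pi (fun _ : ι => D) (fun _ => hf) fun _ => hfH) hs).trans_eq ?_
  congr 2
  rw [sum_const, card_univ]
  push_cast
  rw [sub_zero, Real.norm_eq_abs, nsmul_eq_mul, div_pow, sq_abs]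
  field_simp

/-- The law of a fair coin, whose tosses randomize the symmetrized process. -/
noncomputable def coin : Measure Bool := (PMF.uniformOfFintype Bool).toMeasure

instance : IsProbabilityMeasure coin := by
  unfold coin
  infer_instance

/-- The vector of Rademacher signs of a sequence of coin tosses, `true` standing for `-1`. -/
noncomputable def signVector (σ : ι → Bool) : EuclideanSpace ℝ ι :=
  WithLp.toLp 2 fun i => if σ i then -1 else 1

lemma integral_coin (f : Bool → ℝ) : ∫ σ, f σ ∂coin = (f true + f false) / 2 := by
  simp only [coin, PMF.integral_eq_sum, Fintype.sum_bool, PMF.uniformOfFintype_apply,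
    Fintype.card_bool, smul_eq_mul]
  norm_num
  ring

lemma hasSubgaussianMGF_inner_signVector (u : EuclideanSpace ℝ ι) :
    HasSubgaussianMGF (fun σ : ι → Bool => innerSL ℝ (signVector σ) u) (‖u‖₊ ^ 2)
      (Measure.pi fun _ => coin) := by
  have hsum := hasSubgaussianMGF_sum_pi (fun _ : ι => coin) (a := fun i => -|u i|)
    (b := fun i => |u i|) (fun i => measurable_of_finite fun τ => (if τ then -1 else 1) * u i)
    fun i τ => abs_le.1 (by cases τ <;> simp)
  convert hsum using 1
  · funext σ
    rw [innerSL_apply_apply, PiLp.inner_apply]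
    exact sum_congr rfl fun i _ => by simp [integral_coin, signVector, mul_comm]
  · ext
    push_cast
    rw [EuclideanSpace.real_norm_sq_eq]
    exact sum_congr rfl fun i _ => by simp [← two_mul]

end SubGaussian

section Chaining

lemma abs_apply_le_of_chain {E : Type*} [NormedAddCommGroup E] [NormedSpace ℝ E]
    {ℓ : StrongDual ℝ E} {v : E} {w : ℕ → E} {t : ℝ} (hw0 : w 0 = 0)
    (hw : Tendsto w atTop (nhds v)) (hstep : ∀ k, |ℓ (w (k + 1) - w k)| ≤ t / 2 * (1 / 2) ^ k) :
    |ℓ v| ≤ t := by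
  have hsum : HasSum (fun k => t / 2 * (1 / 2 : ℝ) ^ k) t := by
    simpa using hasSum_geometric_two.mul_left (t / 2)
  refine le_of_tendsto ((ℓ.continuous.tendsto v).comp hw).abs (.of_forall fun n => ?_)
  calc |ℓ (w n)| = |∑ k ∈ range n, ℓ (w (k + 1) - w k)| := by
        rw [← map_sum, sum_range_sub, hw0, sub_zero]
    _ ≤ ∑ k ∈ range n, t / 2 * (1 / 2) ^ k :=
        (abs_sum_le_sum_abs _ _).trans (sum_le_sum fun k _ => hstep k)
    _ ≤ t := sum_le_hasSum _ (fun k _ => (abs_nonneg _).trans (hstep k)) hsum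

variable {Ω E : Type*} [MeasurableSpace Ω] {P : Measure Ω} [NormedAddCommGroup E] [NormedSpace ℝ E]
  {Z : Ω → StrongDual ℝ E} {a b t R : ℝ}

lemma measureReal_exists_mem_le_abs_apply_le
    (hZ : ∀ u, HasSubgaussianMGF (fun ω => Z ω u) (‖u‖₊ ^ 2) P) (U : Finset E) {ρ s : ℝ}
    (hU : ∀ u ∈ U, ‖u‖ ≤ ρ) (hs : 0 ≤ s) :
    P.real {ω | ∃ u ∈ U, s ≤ |Z ω u|} ≤ #U * (2 * Real.exp (-(s ^ 2 / (2 * ρ ^ 2)))) := by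
  have hunion : {ω | ∃ u ∈ U, s ≤ |Z ω u|} = ⋃ u ∈ U, {ω | s ≤ |Z ω u|} := by
    ext ω
    simp only [Set.mem_ofPred_eq, Set.mem_iUnion, exists_prop]
  rw [hunion, ← nsmul_eq_mul]
  refine (measureReal_biUnion_finset_le _ _).trans (sum_le_card_nsmul _ _ _ fun u hu => ?_)
  have hρ : 0 ≤ ρ := (norm_nonneg u).trans (hU u hu)
  have hc : ‖u‖₊ ^ 2 ≤ ρ.toNNReal ^ 2 := by
    gcongr
    exact NNReal.le_toNNReal_of_coe_le (hU u hu)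
  refine (measureReal_le_abs_le_of_hasSubgaussianMGF (hasSubgaussianMGF_mono (hZ u) hc)
    hs).trans_eq ?_
  rw [NNReal.coe_pow, Real.coe_toNNReal _ hρ, neg_div]

lemma link_exponent_le (hR : 0 < R) (ha : 0 ≤ a) (hb : 0 ≤ b)
    (ht : 13 * R ^ 2 * (2 * a + b) ≤ t ^ 2) (k : ℕ) :
    a * k + a * (k + 1 : ℕ) - (t / 2 * (1 / 2) ^ k) ^ 2 / (2 * (5 / 4 * R / 4 ^ k) ^ 2) ≤
      -(b * (k + 1 : ℕ)) := by
  have hpow : (k + 1 : ℝ) ≤ 4 ^ k := by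
    exact_mod_cast k.lt_pow_self (by norm_num : 1 < 4)
  have hquot : (t / 2 * (1 / 2) ^ k) ^ 2 / (2 * (5 / 4 * R / 4 ^ k) ^ 2) =
      2 / 25 * (t ^ 2 / R ^ 2) * 4 ^ k := by
    have h4 : (4 : ℝ) ^ k = (2 ^ k) ^ 2 := by rw [← pow_mul, mul_comm, pow_mul]; norm_num
    rw [h4, one_div, inv_pow]
    field_simp
    norm_num
  have hlin : 2 * a + b ≤ 2 / 25 * (t ^ 2 / R ^ 2) := by
    have : 13 * (2 * a + b) ≤ t ^ 2 / R ^ 2 := by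
      rw [le_div_iff₀ (by positivity)]
      linarith
    linarith
  have : (2 * a + b) * (k + 1) ≤ 2 / 25 * (t ^ 2 / R ^ 2) * 4 ^ k := by gcongr
  rw [hquot]
  push_cast
  nlinarith

lemma measureReal_exists_link_le
    (hZ : ∀ u, HasSubgaussianMGF (fun ω => Z ω u) (‖u‖₊ ^ 2) P) (hR : 0 < R) (ha : 0 ≤ a)
    (hb : 0 ≤ b) (ht0 : 0 ≤ t) (ht : 13 * R ^ 2 * (2 * a + b) ≤ t ^ 2) {N : ℕ → Finset E}
    (hN : ∀ k, (#(N k) : ℝ) ≤ Real.exp (a * k)) (k : ℕ) :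
    P.real {ω | ∃ w ∈ N k, ∃ w' ∈ N (k + 1), ‖w' - w‖ ≤ 5 / 4 * R / 4 ^ k ∧
      t / 2 * (1 / 2) ^ k ≤ |Z ω (w' - w)|} ≤ 2 * Real.exp (-(b * (k + 1 : ℕ))) := by
  classical
  let U : Finset E := {u ∈ (N k ×ˢ N (k + 1)).image fun q => q.2 - q.1 | ‖u‖ ≤ 5 / 4 * R / 4 ^ k}
  have hcard : (#U : ℝ) ≤ Real.exp (a * k) * Real.exp (a * (k + 1 : ℕ)) := by
    refine le_trans ?_ (mul_le_mul (hN k) (hN (k + 1)) (Nat.cast_nonneg _) (Real.exp_pos _).le)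
    exact_mod_cast (card_filter_le _ _).trans (card_image_le.trans_eq (card_product _ _))
  have hevent : {ω | ∃ w ∈ N k, ∃ w' ∈ N (k + 1), ‖w' - w‖ ≤ 5 / 4 * R / 4 ^ k ∧
      t / 2 * (1 / 2) ^ k ≤ |Z ω (w' - w)|} = {ω | ∃ u ∈ U, t / 2 * (1 / 2) ^ k ≤ |Z ω u|} := by
    ext ω
    simp only [U, mem_filter, mem_image, mem_product, Prod.exists, Set.mem_ofPred_eq]
    constructor
    · rintro ⟨w, hw, w', hw', hle, hlt⟩
      exact ⟨w' - w, ⟨⟨w, w', ⟨hw, hw'⟩, rfl⟩, hle⟩, hlt⟩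
    · rintro ⟨_, ⟨⟨w, w', ⟨hw, hw'⟩, rfl⟩, hle⟩, hlt⟩
      exact ⟨w, hw, w', hw', hle, hlt⟩
  rw [hevent]
  refine (measureReal_exists_mem_le_abs_apply_le hZ U (fun u hu => (mem_filter.1 hu).2)
    (by positivity)).trans ?_
  calc _ ≤ Real.exp (a * k) * Real.exp (a * (k + 1 : ℕ)) * (2 * Real.exp
        (-((t / 2 * (1 / 2) ^ k) ^ 2 / (2 * (5 / 4 * R / 4 ^ k) ^ 2)))) := by gcongr
    _ = 2 * Real.exp (a * k + a * (k + 1 : ℕ) -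
        (t / 2 * (1 / 2) ^ k) ^ 2 / (2 * (5 / 4 * R / 4 ^ k) ^ 2)) := by
        rw [sub_eq_add_neg, Real.exp_add, Real.exp_add]
        ring
    _ ≤ _ := by
        gcongr
        exact link_exponent_le hR ha hb ht k

lemma exp_neg_le_half (hb : 1 ≤ b) : Real.exp (-b) ≤ 1 / 2 := by
  calc Real.exp (-b) ≤ Real.exp (-1) := by gcongr
    _ ≤ 1 / 2 := by
      rw [Real.exp_neg, ← one_div]
      gcongr
      linarith [Real.exp_one_gt_d9]

lemma measureReal_iUnion_le_of_le_exp [IsFiniteMeasure P] {s : ℕ → Set Ω} (hb : 1 ≤ b)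
    (hs : ∀ k, P.real (s k) ≤ 2 * Real.exp (-(b * (k + 1 : ℕ)))) :
    P.real (⋃ k, s k) ≤ 4 * Real.exp (-b) := by
  have hterm (k : ℕ) : P (s k) ≤ ENNReal.ofReal (2 * Real.exp (-b) * (1 / 2) ^ k) := by
    rw [← ENNReal.ofReal_toReal (measure_ne_top P (s k))]
    refine ENNReal.ofReal_le_ofReal ((hs k).trans ?_)
    calc 2 * Real.exp (-(b * (k + 1 : ℕ))) = 2 * Real.exp (-b) * Real.exp (-b) ^ k := by
          rw [← neg_mul, mul_comm (-b), Real.exp_nat_mul, pow_succ']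
          ring
      _ ≤ 2 * Real.exp (-b) * (1 / 2) ^ k := by
          gcongr
          exact exp_neg_le_half hb
  have hgeom : HasSum (fun k : ℕ => 2 * Real.exp (-b) * (1 / 2 : ℝ) ^ k) (4 * Real.exp (-b)) := by
    rw [show 4 * Real.exp (-b) = 2 * Real.exp (-b) * 2 by ring]
    exact hasSum_geometric_two.mul_left _
  refine ENNReal.toReal_le_of_le_ofReal (by positivity) ?_
  calc P (⋃ k, s k) ≤ ∑' k : ℕ, ENNReal.ofReal (2 * Real.exp (-b) * (1 / 2) ^ k) :=
        (measure_iUnion_le s).trans (ENNReal.tsum_le_tsum hterm)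
    _ = ENNReal.ofReal (4 * Real.exp (-b)) := by
        rw [← ENNReal.ofReal_tsum_of_nonneg (fun _ => by positivity) hgeom.summable, hgeom.tsum_eq]

lemma measureReal_exists_lt_abs_apply_le_of_nets [IsFiniteMeasure P]
    (hZ : ∀ u, HasSubgaussianMGF (fun ω => Z ω u) (‖u‖₊ ^ 2) P) (hR : 0 < R) (ha : 0 ≤ a)
    (hb : 1 ≤ b) (ht0 : 0 ≤ t) (ht : 13 * R ^ 2 * (2 * a + b) ≤ t ^ 2) {N : ℕ → Finset E}
    (hN0 : N 0 = {0}) (hN : ∀ k, (#(N k) : ℝ) ≤ Real.exp (a * k)) {T : Set E}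
    (hT : ∀ k, ∀ v ∈ T, ∃ w ∈ N k, ‖v - w‖ ≤ R / 4 ^ k) :
    P.real {ω | ∃ v ∈ T, t < |Z ω v|} ≤ 4 * Real.exp (-b) := by
  refine (measureReal_mono ?_).trans <| measureReal_iUnion_le_of_le_exp hb
    (measureReal_exists_link_le hZ hR ha (zero_le_one.trans hb) ht0 ht hN)
  rintro ω ⟨v, hv, hlt⟩
  choose w hwN hw using fun k => hT k v hv
  have hlim : Tendsto w atTop (nhds v) := by
    refine tendsto_iff_norm_sub_tendsto_zero.2 (squeeze_zero (fun _ => norm_nonneg _)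
      (fun k => (norm_sub_rev _ _).trans_le (hw k)) ?_)
    simpa [div_eq_mul_inv] using (tendsto_pow_atTop_nhds_zero_of_lt_one (r := (4 : ℝ)⁻¹)
      (by norm_num) (by norm_num)).const_mul R
  have hlink (k : ℕ) : ‖w (k + 1) - w k‖ ≤ 5 / 4 * R / 4 ^ k := by
    calc ‖w (k + 1) - w k‖ ≤ ‖w (k + 1) - v‖ + ‖v - w k‖ := norm_sub_le_norm_sub_add_norm_sub ..
      _ ≤ R / 4 ^ (k + 1) + R / 4 ^ k :=
          add_le_add ((norm_sub_rev _ _).trans_le (hw (k + 1))) (hw k)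
      _ = 5 / 4 * R / 4 ^ k := by ring
  by_contra hω
  simp only [Set.mem_iUnion, Set.mem_ofPred_eq, not_exists, not_and, not_le] at hω
  have hw0 : w 0 = 0 := by simpa [hN0] using hwN 0
  exact hlt.not_ge <| abs_apply_le_of_chain hw0 hlim fun k =>
    (hω k (w k) (hwN k) (w (k + 1)) (hwN (k + 1)) (hlink k)).le

end Chaining

section Symmetrization

lemma measureReal_le_of_forall_measureReal_setOf_mem_le {Ω Y : Type*} [MeasurableSpace Ω]
    [Countable Ω] [MeasurableSingletonClass Ω] [MeasurableSpace Y] (ν : Measure Ω)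
    [IsProbabilityMeasure ν] {μ : Measure Y} [IsProbabilityMeasure μ] {T : Ω → Y → Y}
    (hT : ∀ σ, MeasurePreserving (T σ) μ μ) {E : Set Y} (hE : MeasurableSet E) {c : ℝ}
    (hc : ∀ y, ν.real {σ | T σ y ∈ E} ≤ c) : μ.real E ≤ c := by
  have hc0 : 0 ≤ c := measureReal_nonneg.trans (hc (nonempty_of_isProbabilityMeasure μ).some)
  have hmeas : MeasurableSet {q : Ω × Y | T q.1 q.2 ∈ E} :=
    (measurable_from_prod_countable_right fun σ => (hT σ).measurable) hE
  have hprod : μ E = (ν.prod μ) {q | T q.1 q.2 ∈ E} := by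
    rw [Measure.prod_apply hmeas]
    calc μ E = ∫⁻ _, μ E ∂ν := by rw [lintegral_const, measure_univ, mul_one]
      _ = _ := lintegral_congr fun σ => ((hT σ).measure_preimage hE.nullMeasurableSet).symm
  refine ENNReal.toReal_le_of_le_ofReal hc0 ?_
  rw [hprod, Measure.prod_apply_symm hmeas]
  calc ∫⁻ y, ν ((fun σ => (σ, y)) ⁻¹' {q | T q.1 q.2 ∈ E}) ∂μ ≤ ∫⁻ _, ENNReal.ofReal c ∂μ :=
        lintegral_mono fun y => (ENNReal.le_ofReal_iff_toReal_le (measure_ne_top ν _) hc0).2 (hc y)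
    _ = ENNReal.ofReal c := by rw [lintegral_const, measure_univ, mul_one]

lemma one_le_measureReal_add_of_compl_subset {Y : Type*} [MeasurableSpace Y] {μ : Measure Y}
    [IsProbabilityMeasure μ] {S B : Set Y} (h : Sᶜ ⊆ B) : 1 ≤ μ.real S + μ.real B := by
  have hcover : S ∪ B = Set.univ := Set.eq_univ_of_forall fun y => (em (y ∈ S)).imp_right (h ·)
  rw [← probReal_univ (μ := μ), ← hcover]
  exact measureReal_union_le S B

lemma mul_measureReal_le_measureReal_prod {Y Y' : Type*} [MeasurableSpace Y] [MeasurableSpace Y']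
    {μ : Measure Y} [IsFiniteMeasure μ] {ν : Measure Y'} [IsFiniteMeasure ν]
    {E : Set (Y × Y')} (hE : MeasurableSet E) {A : Set Y} {c : ℝ} (hc : 0 ≤ c)
    (hA : ∀ y ∈ A, c ≤ ν.real (Prod.mk y ⁻¹' E)) : c * μ.real A ≤ (μ.prod ν).real E := by
  have hsub : A ⊆ {y | ENNReal.ofReal c ≤ ν (Prod.mk y ⁻¹' E)} := fun y hy =>
    ENNReal.ofReal_le_of_le_toReal (hA y hy)
  have hmarkov : ENNReal.ofReal c * μ A ≤ (μ.prod ν) E := by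
    rw [Measure.prod_apply hE]
    exact (mul_le_mul_right (measure_mono hsub) _).trans
      (mul_meas_ge_le_lintegral (measurable_measure_prodMk_left hE) _)
  simpa [measureReal_def, hc] using ENNReal.toReal_mono (measure_ne_top _ _) hmarkov

variable {X ι : Type*}

/-- Exchanges the `i`-th points of the two halves of a double sample for those `i` whose toss is
`true`, the random exchange of symmetrization. -/
def exchange (σ : ι → Bool) (p : (ι → X) × (ι → X)) : (ι → X) × (ι → X) :=
  (fun i => if σ i then p.2 i else p.1 i, fun i => if σ i then p.1 i else p.2 i)

variable [Fintype ι]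

lemma innerSL_signVector_sampleDiff (σ : ι → Bool) (p : (ι → X) × (ι → X)) (f : X → ℝ) :
    innerSL ℝ (signVector σ) (sampleDiff p.1 p.2 f) =
      ∑ i, (f ((exchange σ p).2 i) - f ((exchange σ p).1 i)) := by
  rw [innerSL_apply_apply, PiLp.inner_apply]
  refine sum_congr rfl fun i _ => ?_
  cases h : σ i <;> simp [signVector, sampleDiff, exchange, h]

variable {F : Set (X → ℝ)} {H b ε : ℝ} {d : ℕ}

lemma measureReal_exists_lt_abs_inner_signVector_le [Nonempty ι] (hd : 1 ≤ d)
    (hdim : pseudoDim F ≤ d) (hH : 0 < H) (hF : ∀ f ∈ F, ∀ x, f x ∈ Set.Icc 0 H) (hb : 1 ≤ b)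
    (hε : 0 ≤ ε) (hcard : 208 * H ^ 2 * (26 * d + b) ≤ Fintype.card ι * ε ^ 2) (x y : ι → X) :
    (Measure.pi fun _ : ι => coin).real {σ | ∃ f ∈ F, Fintype.card ι * (ε / 2) <
      |innerSL ℝ (signVector σ) (sampleDiff x y f)|} ≤ 4 * Real.exp (-b) := by
  obtain ⟨N, hN0, hN, hNF⟩ := exists_nets_sampleDiff hd hdim hH hF x y
  have ht : 13 * (2 * H * √(Fintype.card ι)) ^ 2 * (2 * (13 * d) + b) ≤
      (Fintype.card ι * (ε / 2)) ^ 2 := by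
    rw [mul_pow, Real.sq_sqrt (Nat.cast_nonneg _)]
    have := mul_le_mul_of_nonneg_left hcard (Nat.cast_nonneg (α := ℝ) (Fintype.card ι))
    linarith
  have hR : 0 < 2 * H * √(Fintype.card ι) :=
    mul_pos (by positivity) (Real.sqrt_pos.2 (mod_cast Fintype.card_pos))
  have hchain := measureReal_exists_lt_abs_apply_le_of_nets hasSubgaussianMGF_inner_signVector hR
    (by positivity) hb (by positivity) ht hN0 hN hNF
  simpa only [Set.exists_mem_image] using hchain

variable [MeasurableSpace X] (D : Measure X) [IsProbabilityMeasure D]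

lemma measurePreserving_exchange (σ : ι → Bool) :
    MeasurePreserving (exchange (X := X) σ)
      ((Measure.pi fun _ => D).prod (Measure.pi fun _ => D))
      ((Measure.pi fun _ => D).prod (Measure.pi fun _ => D)) := by
  let swapIf (i : ι) : X × X → X × X := if σ i then Prod.swap else id
  have hswap : MeasurePreserving (fun (z : ι → X × X) i => swapIf i (z i))
      (Measure.pi fun _ => D.prod D) (Measure.pi fun _ => D.prod D) := by
    refine measurePreserving_pi _ _ fun i => ?_
    by_cases h : σ i
    · simpa [swapIf, h] using Measure.measurePreserving_swap
    · simpa [swapIf, h] using MeasurePreserving.id _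
  have hpair := measurePreserving_arrowProdEquivProdArrow X X ι (fun _ => D) (fun _ => D)
  convert hpair.comp (hswap.comp (hpair.symm _)) using 1
  funext p
  refine Prod.ext (funext fun i => ?_) (funext fun i => ?_) <;>
    cases h : σ i <;>
    simp [exchange, swapIf, h, MeasurableEquiv.arrowProdEquivProdArrow,
      Equiv.arrowProdEquivProdArrow]

lemma measureReal_double_sample_deviation_le [Nonempty ι] (hd : 1 ≤ d) (hdim : pseudoDim F ≤ d)
    (hH : 0 < H) (hF : ∀ f ∈ F, ∀ x, f x ∈ Set.Icc 0 H) (hb : 1 ≤ b) (hε : 0 ≤ ε)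
    (hcard : 208 * H ^ 2 * (26 * d + b) ≤ Fintype.card ι * ε ^ 2) {g : (ι → X) → X → ℝ}
    (hgF : ∀ x, g x ∈ F)
    (hE : MeasurableSet {p : (ι → X) × (ι → X) |
      Fintype.card ι * (ε / 2) < |∑ i, (g p.1 (p.2 i) - g p.1 (p.1 i))|}) :
    ((Measure.pi fun _ => D).prod (Measure.pi fun _ => D)).real {p : (ι → X) × (ι → X) |
      Fintype.card ι * (ε / 2) < |∑ i, (g p.1 (p.2 i) - g p.1 (p.1 i))|} ≤
        4 * Real.exp (-b) := by
  refine measureReal_le_of_forall_measureReal_setOf_mem_le (Measure.pi fun _ => coin)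
    (measurePreserving_exchange D) hE fun p => ?_
  refine (measureReal_mono fun σ hσ => ?_).trans
    (measureReal_exists_lt_abs_inner_signVector_le hd hdim hH hF hb hε hcard p.1 p.2)
  refine ⟨g (exchange σ p).1, hgF _, ?_⟩
  rw [innerSL_signVector_sampleDiff]
  exact hσ

lemma measureReal_deviation_le [Nonempty ι] {f : X → ℝ} (hf : Measurable f) (hH : 0 < H)
    (hfH : ∀ x, f x ∈ Set.Icc 0 H) (hε : 0 ≤ ε)
    (hcard : 2 * H ^ 2 * (b + 1) ≤ Fintype.card ι * ε ^ 2) :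
    (Measure.pi fun _ : ι => D).real
      {x | Fintype.card ι * (ε / 2) ≤ |∑ i, (f (x i) - ∫ y, f y ∂D)|} ≤ Real.exp (-b) := by
  refine (measureReal_hoeffding D hf hfH (by positivity)).trans ?_
  have hexponent : b + 1 ≤
      2 * (Fintype.card ι * (ε / 2)) ^ 2 / (Fintype.card ι * H ^ 2) := by
    have : (0 : ℝ) < Fintype.card ι := mod_cast Fintype.card_pos
    rw [le_div_iff₀ (by positivity)]
    nlinarith
  calc 2 * Real.exp (-(2 * (Fintype.card ι * (ε / 2)) ^ 2 / (Fintype.card ι * H ^ 2)))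
      ≤ 2 * (Real.exp (-b) * Real.exp (-1)) := by
        rw [← Real.exp_add, ← neg_add]
        gcongr
    _ ≤ Real.exp (-b) := by nlinarith [Real.exp_pos (-b), exp_neg_le_half le_rfl]

lemma measurableSet_ghost_deviation {g : (ι → X) → X → ℝ}
    (hg : Measurable fun p : (ι → X) × X => g p.1 p.2) (t : ℝ) :
    MeasurableSet {p : (ι → X) × (ι → X) | t < |∑ i, (g p.1 (p.2 i) - g p.1 (p.1 i))|} := by
  refine measurableSet_lt measurable_const (_root_.measurable_abs.comp
    (Finset.measurable_sum _ fun i _ => Measurable.sub ?_ ?_))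
  · exact hg.comp (measurable_fst.prodMk ((measurable_pi_apply i).comp measurable_snd))
  · exact hg.comp (measurable_fst.prodMk ((measurable_pi_apply i).comp measurable_fst))

lemma measureReal_lt_abs_sum_sub_integral_le_ghost {g : (ι → X) → X → ℝ} {t : ℝ}
    (hg : Measurable fun p : (ι → X) × X => g p.1 p.2)
    (hghost : ∀ x, (Measure.pi fun _ : ι => D).real
      {y | t ≤ |∑ i, (g x (y i) - ∫ z, g x z ∂D)|} ≤ 1 / 2) :
    (Measure.pi fun _ : ι => D).real {x | 2 * t < |∑ i, (g x (x i) - ∫ z, g x z ∂D)|} ≤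
      2 * ((Measure.pi fun _ => D).prod (Measure.pi fun _ => D)).real
        {p : (ι → X) × (ι → X) | t < |∑ i, (g p.1 (p.2 i) - g p.1 (p.1 i))|} := by
  have hmarkov := mul_measureReal_le_measureReal_prod (μ := Measure.pi fun _ : ι => D)
    (ν := Measure.pi fun _ : ι => D) (measurableSet_ghost_deviation hg t)
    (A := {x | 2 * t < |∑ i, (g x (x i) - ∫ z, g x z ∂D)|}) (c := 1 / 2) (by norm_num)
    fun x hx => ?_
  · linarith
  rw [Set.mem_ofPred_eq] at hx
  have hcompl : {y : ι → X | t ≤ |∑ i, (g x (y i) - ∫ z, g x z ∂D)|}ᶜ ⊆ Prod.mk x ⁻¹'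
      {p : (ι → X) × (ι → X) | t < |∑ i, (g p.1 (p.2 i) - g p.1 (p.1 i))|} := fun y hy => by
    simp only [Set.mem_compl_iff, Set.mem_preimage, Set.mem_ofPred_eq, not_le,
      sum_sub_distrib] at hx hy ⊢
    have := abs_sub_le (∑ i, g x (x i)) (∑ i, g x (y i)) (∑ _ : ι, ∫ z, g x z ∂D)
    rw [abs_sub_comm _ (∑ i, g x (y i))] at this
    linarith
  have hle := one_le_measureReal_add_of_compl_subset (μ := Measure.pi fun _ : ι => D) hcompl
  linarith [hghost x]

lemma measureReal_generalization_gap_le [Nonempty ι] (hd : 1 ≤ d) (hdim : pseudoDim F ≤ d)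
    (hH : 0 < H) (hFm : ∀ f ∈ F, Measurable f) (hF : ∀ f ∈ F, ∀ x, f x ∈ Set.Icc 0 H) (hb : 1 ≤ b)
    (hε : 0 ≤ ε) (hcard : 208 * H ^ 2 * (26 * d + b) ≤ Fintype.card ι * ε ^ 2)
    {g : (ι → X) → X → ℝ} (hgF : ∀ x, g x ∈ F)
    (hg : Measurable fun p : (ι → X) × X => g p.1 p.2) :
    (Measure.pi fun _ : ι => D).real
      {x | Fintype.card ι * ε < |∑ i, (g x (x i) - ∫ y, g x y ∂D)|} ≤ 8 * Real.exp (-b) := by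
  have hcard' : 2 * H ^ 2 * (b + 1) ≤ Fintype.card ι * ε ^ 2 := by
    refine le_trans ?_ hcard
    have : (0 : ℝ) ≤ d := Nat.cast_nonneg d
    nlinarith [sq_nonneg H]
  have hghost := measureReal_lt_abs_sum_sub_integral_le_ghost D (t := Fintype.card ι * (ε / 2)) hg
    fun x => (measureReal_deviation_le D (hFm _ (hgF x)) hH (hF _ (hgF x)) hε hcard').trans
      (exp_neg_le_half hb)
  rw [show 2 * (Fintype.card ι * (ε / 2)) = Fintype.card ι * ε by ring] at hghost
  linarith [measureReal_double_sample_deviation_le D hd hdim hH hF hb hε hcard hgF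
    (measurableSet_ghost_deviation hg _)]

end Symmetrization

lemma pos_of_nontrivial {X : Type*} {F : Set (X → ℝ)} {H : ℝ}
    (hF : ∀ f ∈ F, ∀ x, f x ∈ Set.Icc 0 H)
    (hnt : F.Nontrivial) : 0 < H := by
  obtain ⟨f, hf, g, hg, hfg⟩ := hnt
  obtain ⟨x, hx⟩ := Function.ne_iff.1 hfg
  obtain hlt | hlt := hx.lt_or_gt
  · exact ((hF f hf x).1.trans_lt hlt).trans_le (hF g hg x).2
  · exact ((hF g hg x).1.trans_lt hlt).trans_le (hF f hf x).2

lemma sample_size_bound {H ε δ : ℝ} {d m : ℕ} (hd : 1 ≤ d) (hε : 0 < ε) (hδ : δ ∈ Set.Ioc 0 1)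
    (hm : 10 ^ 4 * (H / ε) ^ 2 * (d + Real.log (1 / δ)) ≤ m) :
    208 * H ^ 2 * (26 * d + Real.log (9 / δ)) ≤ m * ε ^ 2 := by
  have hd' : (1 : ℝ) ≤ d := mod_cast hd
  have hlog : 0 ≤ Real.log (1 / δ) := Real.log_nonneg (one_le_one_div hδ.1 hδ.2)
  have hlog9 : Real.log (9 / δ) ≤ 3 + Real.log (1 / δ) := by
    rw [div_eq_mul_one_div, Real.log_mul (by norm_num) (one_div_pos.2 hδ.1).ne']
    gcongr
    rw [show (9 : ℝ) = 3 ^ 2 by norm_num, Real.log_pow]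
    push_cast
    linarith [Real.log_three_lt_d9]
  calc 208 * H ^ 2 * (26 * d + Real.log (9 / δ)) = H ^ 2 * (208 * (26 * d + Real.log (9 / δ))) := by
        ring
    _ ≤ H ^ 2 * (10 ^ 4 * (d + Real.log (1 / δ))) :=
        mul_le_mul_of_nonneg_left (by linarith) (sq_nonneg H)
    _ = 10 ^ 4 * (H / ε) ^ 2 * (d + Real.log (1 / δ)) * ε ^ 2 := by field_simp
    _ ≤ m * ε ^ 2 := by gcongr

section ERM

variable {X 𝒜 : Type*} [MeasurableSpace X] {cost : 𝒜 → X → ℝ} {H : ℝ}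

lemma expCost_mem_Icc (hcost : ∀ A x, cost A x ∈ Set.Icc 0 H) (hmeas : ∀ A, Measurable (cost A))
    (D : Measure X) [IsProbabilityMeasure D] (A : 𝒜) : expCost cost D A ∈ Set.Icc 0 H :=
  (convex_Icc 0 H).integral_mem isClosed_Icc (.of_forall (hcost A))
    (.of_mem_Icc 0 H (hmeas A).aemeasurable (.of_forall (hcost A)))

lemma abs_avgCost_sub_expCost_le {n : ℕ} (hn : 0 < n) {D : Measure X} {x : Fin n → X} {A : 𝒜}
    {α : ℝ} (h : |∑ i, (cost A (x i) - ∫ y, cost A y ∂D)| ≤ n * α) :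
    |avgCost cost x A - expCost cost D A| ≤ α := by
  have hn' : (0 : ℝ) < n := mod_cast hn
  rw [sum_sub_distrib, sum_const, card_univ, Fintype.card_fin, nsmul_eq_mul] at h
  rw [avgCost, expCost, div_sub' hn'.ne', abs_div, abs_of_pos hn', div_le_iff₀' hn']
  exact h

lemma one_sub_le_measureReal_error_le_of_isERM {goal : Goal} {L : Learner X 𝒜}
    (hERM : IsERM goal cost L) {d m : ℕ} {b ε : ℝ} (hd : 1 ≤ d)
    (hdim : pseudoDim (Set.range cost) ≤ d) (hH : 0 < H) (hcost : ∀ A x, cost A x ∈ Set.Icc 0 H)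
    (hmeas : ∀ A, Measurable (cost A))
    (hL : Measurable fun p : (Fin m → X) × X => cost (L m p.1) p.2) (hb : 1 ≤ b) (hε : 0 < ε)
    (hm : 208 * H ^ 2 * (26 * d + b) ≤ m * ε ^ 2) (D : Measure X) [IsProbabilityMeasure D] :
    1 - 9 * Real.exp (-b) ≤
      (Measure.pi fun _ : Fin m => D).real {x | error goal cost D (L m x) ≤ 2 * ε} := by
  have hm0 : 0 < m := by
    have : (0 : ℝ) < m * ε ^ 2 := lt_of_lt_of_le (by positivity) hm
    exact_mod_cast pos_of_mul_pos_left this (sq_nonneg ε)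
  have : Nonempty (Fin m) := ⟨⟨0, hm0⟩⟩
  obtain ⟨x₀⟩ := nonempty_of_isProbabilityMeasure (Measure.pi fun _ : Fin m => D)
  have : Nonempty 𝒜 := ⟨L m x₀⟩
  have hexp := expCost_mem_Icc hcost hmeas D
  obtain ⟨B, hB⟩ := goal.exists_abs_sub_best_le hexp (half_pos hε)
  rw [← Fintype.card_fin m] at hm
  have hgap := measureReal_generalization_gap_le D hd hdim hH (Set.forall_mem_range.2 hmeas)
    (Set.forall_mem_range.2 hcost) hb hε.le hm (fun x => Set.mem_range_self (L m x)) hL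
  have hdev := measureReal_deviation_le (ι := Fin m) D (hmeas B) hH (hcost B) hε.le (b := b) <| by
    nlinarith [sq_nonneg H, (Nat.cast_nonneg d : (0 : ℝ) ≤ d)]
  rw [Fintype.card_fin] at hgap hdev
  set bad₁ := {x : Fin m → X | m * ε < |∑ i, (cost (L m x) (x i) - ∫ y, cost (L m x) y ∂D)|}
  set bad₂ := {x : Fin m → X | m * (ε / 2) ≤ |∑ i, (cost B (x i) - ∫ y, cost B y ∂D)|}
  have hgood : {x | error goal cost D (L m x) ≤ 2 * ε}ᶜ ⊆ bad₁ ∪ bad₂ :=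
    Set.compl_subset_comm.1 fun x hx => by
      obtain ⟨hx₁, hx₂⟩ := not_or.1 hx
      have hLx := abs_avgCost_sub_expCost_le hm0 (not_lt.1 hx₁)
      have hBx := abs_avgCost_sub_expCost_le hm0 (not_le.1 hx₂).le
      have := (goal.asGoodAs_best hexp _).abs_sub_le (hERM m x B) hB hLx hBx
      rw [Set.mem_ofPred_eq, error]
      linarith
  linarith [one_le_measureReal_add_of_compl_subset (μ := Measure.pi fun _ : Fin m => D) hgood,
    measureReal_union_le (μ := Measure.pi fun _ : Fin m => D) bad₁ bad₂]

end ERM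

end AlgSelect

/-- The constant `c` is universal. The two measurability hypotheses say that expected costs make
sense, and that the cost of the learner's output on a fresh instance is a measurable function of
the sample and the fresh instance. -/
theorem corollary3p2 :
    ∃ c : ℝ, 0 < c ∧
      ∀ (X : Type*) [MeasurableSpace X] (𝒜 : Type*) (goal : AlgSelect.Goal)
        (cost : 𝒜 → X → ℝ) (H ε δ : ℝ) (d m : ℕ) (L : AlgSelect.Learner X 𝒜),
        (∀ A x, cost A x ∈ Set.Icc 0 H) →
        (∀ A, Measurable (cost A)) →
        Measurable (fun p : (Fin m → X) × X => cost (L m p.1) p.2) →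
        0 < ε → δ ∈ Set.Ioc 0 1 →
        AlgSelect.pseudoDim (Set.range cost) = d →
        AlgSelect.IsERM goal cost L →
        c * (H / ε) ^ 2 * (d + Real.log (1 / δ)) ≤ m →
        AlgSelect.LearnsOptimal goal cost L (2 * ε) δ m := by
  refine ⟨10 ^ 4, by norm_num,
    fun X _ 𝒜 goal cost H ε δ d m L hcost hmeas hL hε hδ hdim hERM hm D _ => ?_⟩
  rcases (Set.range cost).subsingleton_or_nontrivial with hsub | hnt
  · simp [AlgSelect.error_eq_zero_of_subsingleton goal hsub, hε.le, hδ.1.le]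
  have hd := AlgSelect.one_le_of_pseudoDim_le hdim.le hnt
  have hH := AlgSelect.pos_of_nontrivial (Set.forall_mem_range.2 hcost) hnt
  have hb : 1 ≤ Real.log (9 / δ) := by
    rw [Real.le_log_iff_exp_le (div_pos (by norm_num) hδ.1), le_div_iff₀ hδ.1]
    nlinarith [Real.exp_one_lt_d9, hδ.1, hδ.2]
  have hexp : 9 * Real.exp (-Real.log (9 / δ)) = δ := by
    rw [← Real.log_inv, inv_div, Real.exp_log (div_pos hδ.1 (by norm_num))]
    ring
  have hlearn := AlgSelect.one_sub_le_measureReal_error_le_of_isERM hERM hd hdim.le hH hcost hmeas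
    hL hb hε (AlgSelect.sample_size_bound hd hε hδ hm) D
  rwa [hexp] at hlearn
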